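/- **Setting.** Let $\mathbb R_+=(0,\infty)$. Let $\phi$ be an increasing function mapping $\mathbb R_+$ onto itself, let $\Phi(x)=\int_0^x\phi(y)\,dy$ be the corresponding $N$-function, and let $\Psi(x)=\int_0^x\phi^{-1}(y)\,dy$ be the complementary $N$-function, where $\phi^{-1}(s)=\inf\{t>0:\phi(t)\ge s\}$ (the ordinary inverse if $\phi$ is strictly increasing); put $\phi(0)=\phi^{-1}(0)=0$, $\phi(\infty)=\phi^{-1}(\infty)=\Phi(\infty)=\Psi(\infty)=\infty$ and $0\cdot\infty=0$. Let $u\ge 0$ be a locally integrable function (weight) on $\mathbb R_+$ and $U(x)=\int_0^x u$. For measurable $f,h:\mathbb R_+\to[0,\infty]$ let $$f^*(t)=\inf\{s\ge 0:\ |\{x\in\mathbb R_+: f(x)>s\}|\le t\},\qquad \rho_{\Phi,u}(h)=\inf\Big\{\lambda>0:\ \int_{\mathbb R_+}\Phi\Big(\frac{h(x)}{\lambda}\Big)u(x)\,dx\le 1\Big\},$$ with $\inf\emptyset=\infty$. **Theorem.** Suppose that $\Phi(2t)\approx\Phi(t)$ for $t\in\mathbb R_+$ (each side is at most a constant multiple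 of the other) and $\int_{\mathbb R_+}u=\infty$. Then there is a constant $C>0$ such that $$\rho_{\Phi,u}\Big(t^{-1}\int_0^t f^*\Big)\le C\,\rho_{\Phi,u}(f^*)\qquad\text{for all measurable } f:\mathbb R_+\to[0,\infty],$$ provided the following two conditions hold: 1. for $\Theta=\Phi$ or for $\Theta=\Psi$, there is $c>0$ such that for all $\lambda,x\in\mathbb R_+$ $$\phi\Big(\frac{c\,\alpha(\lambda,x)}{\lambda}\Big)U(x)\le c^{-1}\lambda,\qquad \alpha(\lambda,x)=\int_x^\infty\Theta\Big(\frac{\lambda}{U(y)}\Big)u(y)\,dy;$$ 2. there is $c>0$ such that for all $\lambda,x\in\mathbb R_+$ $$\int_0^x\phi^{-1}\Big(\frac{c\,\beta(\lambda,x)}{\lambda}\,\frac{y}{U(y)}\Big)\frac{y\,u(y)}{U(y)}\,dy\le c^{-1}\lambda,\qquad \beta(\lambda,x)=\int_x^\infty\Phi\Big(\frac{\lambda}{y}\Big)u(y)\,dy.$$ -/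

import Mathlib

open Set MeasureTheory
open scoped ENNReal NNReal

noncomputable section

namespace OrliczLorentz

/-- `φ` is an increasing map of `(0, ∞)` onto itself, regarded as a map of `[0, ∞]`. Monotonicity on
`[0, ∞]` forces `φ 0 = 0` and `φ ∞ = ∞` (the limits of `φ` at the two ends), so nothing but the
values on `(0, ∞)` is being chosen. -/
def IsDensity (φ : ℝ≥0∞ → ℝ≥0∞) : Prop :=
  Monotone φ ∧ φ '' Ioo 0 ⊤ = Ioo 0 ⊤

/-- `Φ(x) = ∫₀ˣ φ(y) dy` for `x ∈ [0, ∞]`. For `φ` as in `IsDensity`, this is the N-function `Φ`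
with derivative `φ`. -/
def primitive (φ : ℝ≥0∞ → ℝ≥0∞) (x : ℝ≥0∞) : ℝ≥0∞ :=
  ∫⁻ y in {y : ℝ | 0 < y ∧ ENNReal.ofReal y < x}, φ (ENNReal.ofReal y)

/-- The inverse `φ⁻¹`. For strictly increasing `φ` it is the ordinary inverse function
(see `inverse_apply`); if `φ` has flat pieces, it is the usual left-continuous inverse. -/
def inverse (φ : ℝ≥0∞ → ℝ≥0∞) (s : ℝ≥0∞) : ℝ≥0∞ :=
  sInf {t | s ≤ φ t}

theorem inverse_apply {φ : ℝ≥0∞ → ℝ≥0∞} (h : StrictMono φ) (t : ℝ≥0∞) :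
    inverse φ (φ t) = t := by
  refine le_antisymm (sInf_le (le_refl (φ t))) (le_sInf fun r hr => ?_)
  exact h.le_iff_le.mp hr

/-- The complementary N-function `Ψ(x) = ∫₀ˣ φ⁻¹(y) dy` of `Φ(x) = ∫₀ˣ φ(y) dy`. -/
def complementary (φ : ℝ≥0∞ → ℝ≥0∞) : ℝ≥0∞ → ℝ≥0∞ :=
  primitive (inverse φ)

/-- `Φ(2t) ≈ Φ(t)` on `(0, ∞)`: each side is at most a constant multiple of the other. -/
def IsDoubling (Φ : ℝ≥0∞ → ℝ≥0∞) : Prop :=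
  ∃ K : ℝ≥0, ∀ t : ℝ≥0∞, 0 < t → t < ⊤ → Φ (2 * t) ≤ K * Φ t ∧ Φ t ≤ K * Φ (2 * t)

/-- A weight on `(0, ∞)`: a nonnegative, locally integrable function. -/
def IsWeight (u : ℝ → ℝ) : Prop :=
  (∀ x, 0 < x → 0 ≤ u x) ∧ LocallyIntegrableOn u (Ioi 0)

/-- `U(x) = ∫₀ˣ u`. -/
def cumul (u : ℝ → ℝ) (x : ℝ) : ℝ≥0∞ :=
  ∫⁻ y in Ioo 0 x, ENNReal.ofReal (u y)

/-- The distribution function `μ_f(l) = |{x ∈ (0, ∞) : f x > l}|`. -/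
def distribution (f : ℝ → ℝ≥0∞) (l : ℝ≥0∞) : ℝ≥0∞ :=
  volume {x : ℝ | 0 < x ∧ l < f x}

/-- The nonincreasing rearrangement `f*(t) = inf {l : μ_f(l) ≤ t}`, the inverse of `μ_f`. -/
def rearrangement (f : ℝ → ℝ≥0∞) (t : ℝ) : ℝ≥0∞ :=
  sInf {l | distribution f l ≤ ENNReal.ofReal t}

/-- The average `t⁻¹ ∫₀ᵗ h`. -/
def average (h : ℝ → ℝ≥0∞) (t : ℝ) : ℝ≥0∞ :=
  (ENNReal.ofReal t)⁻¹ * ∫⁻ s in Ioo 0 t, h s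

/-- The gauge functional `ρ_{Φ,u}(h) = inf {l ∈ (0, ∞) : ∫₀^∞ Φ(h(x)/l) u(x) dx ≤ 1}`, with value
`∞` if there is no such `l`. -/
def gauge (Φ : ℝ≥0∞ → ℝ≥0∞) (u : ℝ → ℝ) (h : ℝ → ℝ≥0∞) : ℝ≥0∞ :=
  sInf {l | 0 < l ∧ l < ⊤ ∧ ∫⁻ x in Ioi 0, Φ (h x / l) * ENNReal.ofReal (u x) ≤ 1}

/-- `α(l, x) = ∫ₓ^∞ Θ(l/U(y)) u(y) dy`. -/
def alpha (Θ : ℝ≥0∞ → ℝ≥0∞) (u : ℝ → ℝ) (l : ℝ≥0) (x : ℝ) : ℝ≥0∞ :=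
  ∫⁻ y in Ioi x, Θ (l / cumul u y) * ENNReal.ofReal (u y)

/-- `β(l, x) = ∫ₓ^∞ Φ(l/y) u(y) dy`. -/
def beta (Φ : ℝ≥0∞ → ℝ≥0∞) (u : ℝ → ℝ) (l : ℝ≥0) (x : ℝ) : ℝ≥0∞ :=
  ∫⁻ y in Ioi x, Φ (l / ENNReal.ofReal y) * ENNReal.ofReal (u y)

/-- For some `c > 0`, all `l, x > 0` satisfy `φ(c α(l, x) / l) U(x) ≤ c⁻¹ l`,
where `α(l, x) = ∫ₓ^∞ Θ(l/U(y)) u(y) dy`. -/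
def AlphaCondition (φ Θ : ℝ≥0∞ → ℝ≥0∞) (u : ℝ → ℝ) : Prop :=
  ∃ c : ℝ≥0, 0 < c ∧ ∀ l : ℝ≥0, 0 < l → ∀ x : ℝ, 0 < x →
    φ (c * alpha Θ u l x / l) * cumul u x ≤ (c : ℝ≥0∞)⁻¹ * l

/-- For some `c > 0`, all `l, x > 0` satisfy
`∫₀ˣ φ⁻¹((c β(l, x) / l) (y / U(y))) (y u(y) / U(y)) dy ≤ c⁻¹ l`,
where `β(l, x) = ∫ₓ^∞ Φ(l/y) u(y) dy` and `Φ` is the primitive of `φ`. -/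
def BetaCondition (φ : ℝ≥0∞ → ℝ≥0∞) (u : ℝ → ℝ) : Prop :=
  ∃ c : ℝ≥0, 0 < c ∧ ∀ l : ℝ≥0, 0 < l → ∀ x : ℝ, 0 < x →
    ∫⁻ y in Ioo 0 x,
      inverse φ (c * beta (primitive φ) u l x / l * (ENNReal.ofReal y / cumul u y)) *
        (ENNReal.ofReal y * ENNReal.ofReal (u y) / cumul u y)
      ≤ (c : ℝ≥0∞)⁻¹ * l

end OrliczLorentz

end

open Filter Topology

namespace OrliczLorentz

/-! ### The density, its primitive and its inverse -/

/-! Put `μ = u dx` on `(0, ∞)`, so that `μ (Iic y) = U(y)`, and let `g` be the rearrangement divided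
by some `l` with modular at most 1. The average of `g` is controlled by a Hardy-type operator whose
kernel is the one in the beta condition.

Pointwise bound (`average_le`): let `h(y)` be the point where `U` reaches `U(y)/2`. Monotonicity of
`g` gives `g(s) ≤ 2 ∫_(s,t] g(h(y)) / U(y) dμ(y) + g(h(t))`. Averaging over `s < t`, Tonelli yields
`2 F(t)/t + g(h(t))`, where `F(t) = ∫_(0,t] (y/U(y)) G(y) dμ(y)` and `G = g ∘ h`. Since `h` pushes
`μ` forward to `2μ`, the modular of `G` is twice that of `g`.

Modular bound (`TailCondition.lintegral_hardy_le`): the integral of `Φ((c/8) F(y)/y)` is at most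
that of `Φ(G)`. Young's inequality, with a multiple of `y/U(y)` as dual variable, combines with the
beta condition to bound a tail integral of `Φ(l/y)` by the integral of `Φ(G)` over a set where `F`
gains a definite amount (`TailCondition.tail_le`). Applied to the dyadic levels of `F`, this bounds
each level by the preceding one, and the levels are summed.

Finally `4 Φ(x/4) ≤ Φ(x)` brings the total modular, at most `2 + 2`, back to 1. -/

theorem IsDensity.map_zero {φ : ℝ≥0∞ → ℝ≥0∞} (h : IsDensity φ) : φ 0 = 0 := by
  by_contra h0
  obtain ⟨b, hb0, hb⟩ := exists_between (pos_iff_ne_zero.2 h0)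
  have hb' : b ∈ φ '' Ioo 0 ⊤ := by
    rw [h.2]
    exact ⟨hb0, hb.trans_le le_top⟩
  obtain ⟨t, -, rfl⟩ := hb'
  exact absurd (h.1 (zero_le (a := t))) (not_le.2 hb)

theorem IsDensity.lt_top {φ : ℝ≥0∞ → ℝ≥0∞} (h : IsDensity φ) {t : ℝ≥0∞} (ht : t < ⊤) :
    φ t < ⊤ := by
  rcases eq_or_ne t 0 with rfl | h0
  · rw [h.map_zero]
    exact ENNReal.zero_lt_top
  · have : φ t ∈ φ '' Ioo 0 ⊤ := mem_image_of_mem _ ⟨pos_iff_ne_zero.2 h0, ht⟩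
    rw [h.2] at this
    exact this.2

theorem IsDensity.pos {φ : ℝ≥0∞ → ℝ≥0∞} (h : IsDensity φ) {t : ℝ≥0∞} (ht : 0 < t) :
    0 < φ t := by
  obtain ⟨s, hs0, hs⟩ := exists_between ht
  have : φ s ∈ φ '' Ioo 0 ⊤ := mem_image_of_mem _ ⟨hs0, hs.trans_le le_top⟩
  rw [h.2] at this
  exact this.1.trans_le (h.1 hs.le)

theorem inverse_mono (φ : ℝ≥0∞ → ℝ≥0∞) : Monotone (inverse φ) :=
  fun _ _ hab => sInf_le_sInf fun _ ht => hab.trans ht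

theorem IsDensity.inverse_pos {φ : ℝ≥0∞ → ℝ≥0∞} (h : IsDensity φ) {s : ℝ≥0∞} (hs : 0 < s) :
    0 < inverse φ s := by
  obtain ⟨b, hb0, hb⟩ := exists_between hs
  have hb' : b ∈ φ '' Ioo 0 ⊤ := by
    rw [h.2]
    exact ⟨hb0, hb.trans_le le_top⟩
  obtain ⟨t, ht, rfl⟩ := hb'
  refine ht.1.trans_le (le_sInf fun r hr => ?_)
  by_contra hlt
  exact absurd (hr.trans (h.1 (not_le.1 hlt).le)) (not_le.2 hb)

theorem IsDensity.inverse_top {φ : ℝ≥0∞ → ℝ≥0∞} (h : IsDensity φ) : inverse φ ⊤ = ⊤ := by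
  refine top_unique (le_sInf fun r hr => ?_)
  by_contra hlt
  exact absurd (h.lt_top (not_le.1 hlt)) (not_lt.2 hr)

theorem measurableSet_pos_lt (x : ℝ≥0∞) : MeasurableSet {y : ℝ | 0 < y ∧ ENNReal.ofReal y < x} :=
  measurableSet_Ioi.inter (measurableSet_lt ENNReal.measurable_ofReal measurable_const)

theorem volume_pos_lt (x : ℝ≥0∞) : volume {y : ℝ | 0 < y ∧ ENNReal.ofReal y < x} = x := by
  rcases eq_or_ne x ⊤ with rfl | hx
  · have : {y : ℝ | 0 < y ∧ ENNReal.ofReal y < ⊤} = Ioi 0 := by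
      ext y
      simp
    rw [this, Real.volume_Ioi]
  · have : {y : ℝ | 0 < y ∧ ENNReal.ofReal y < x} = Ioo 0 x.toReal := by
      ext y
      simp only [mem_ofPred_eq, mem_Ioo, and_congr_right_iff]
      intro hy
      exact ENNReal.ofReal_lt_iff_lt_toReal hy.le hx
    rw [this, Real.volume_Ioo, sub_zero, ENNReal.ofReal_toReal hx]

theorem primitive_mono (φ : ℝ≥0∞ → ℝ≥0∞) : Monotone (primitive φ) :=
  fun _ _ hab => lintegral_mono_set fun _ hy => ⟨hy.1, hy.2.trans_le hab⟩

theorem primitive_zero (φ : ℝ≥0∞ → ℝ≥0∞) : primitive φ 0 = 0 := by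
  simp [primitive]

theorem IsDensity.primitive_pos {φ : ℝ≥0∞ → ℝ≥0∞} (h : IsDensity φ) {x : ℝ≥0∞} (hx : 0 < x) :
    0 < primitive φ x := by
  have hm : Measurable fun y : ℝ => φ (ENNReal.ofReal y) :=
    h.1.measurable.comp ENNReal.measurable_ofReal
  rw [primitive, setLIntegral_pos_iff hm]
  refine lt_of_lt_of_eq hx ((volume_pos_lt x).symm.trans ?_)
  congr 1
  ext y
  simp only [mem_ofPred_eq, Function.mem_support, mem_inter_iff, iff_and_self]
  exact fun hy => (h.pos (ENNReal.ofReal_pos.2 hy.1)).ne'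

/-- A form of Young's inequality. -/
theorem mul_le_primitive_add {φ : ℝ≥0∞ → ℝ≥0∞} (h : Monotone φ) (a b : ℝ≥0∞) :
    a * b ≤ primitive φ a + b * inverse φ b := by
  -- Past `inverse φ b` the density is at least `b`, so only an interval of length at most `inverse
  -- φ b` is left to pay for. Integrating over `(0, a)` gives the inequality.
  have key : ∀ y : ℝ≥0∞, b ≤ φ y + {z | z ≤ inverse φ b}.indicator (fun _ => b) y := by
    intro y
    by_cases hy : y ≤ inverse φ b
    · rw [indicator_of_mem (by exact hy)]
      exact le_add_self
    · obtain ⟨t, ht, hty⟩ := sInf_lt_iff.1 (not_le.1 hy)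
      exact (ht.trans (h hty.le)).trans le_self_add
  have hms : MeasurableSet {z : ℝ | ENNReal.ofReal z ≤ inverse φ b} :=
    measurableSet_le ENNReal.measurable_ofReal measurable_const
  calc a * b = ∫⁻ y in {y : ℝ | 0 < y ∧ ENNReal.ofReal y < a}, b := by
        rw [setLIntegral_const, volume_pos_lt, mul_comm]
    _ ≤ ∫⁻ y in {y : ℝ | 0 < y ∧ ENNReal.ofReal y < a}, (φ (ENNReal.ofReal y) +
          {z : ℝ | ENNReal.ofReal z ≤ inverse φ b}.indicator (fun _ => b) y) :=
        lintegral_mono fun y => key (ENNReal.ofReal y)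
    _ = primitive φ a + ∫⁻ y in {y : ℝ | 0 < y ∧ ENNReal.ofReal y < a},
          {z : ℝ | ENNReal.ofReal z ≤ inverse φ b}.indicator (fun _ => b) y :=
        lintegral_add_left (h.measurable.comp ENNReal.measurable_ofReal) _
    _ ≤ primitive φ a + b * inverse φ b := by
        gcongr
        rw [lintegral_indicator hms, setLIntegral_const, Measure.restrict_apply hms]
        gcongr
        -- The set allows `y = inverse φ b` while `volume_pos_lt` has a strict bound, hence the
        -- slightly larger `d`.
        refine le_of_forall_gt fun c hc => ?_
        obtain ⟨d, hd, hdc⟩ := exists_between hc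
        refine lt_of_le_of_lt ((measure_mono fun y hy => ?_).trans (volume_pos_lt d).le) hdc
        exact ⟨hy.2.1, lt_of_le_of_lt hy.1 hd⟩

/-- The only form of convexity needed: the substitution `y ↦ 2y` turns `Φ(x)` into twice the
integral of `φ(2y) ≥ φ(y)` over `(0, x/2)`. -/
theorem two_mul_primitive_half_le {φ : ℝ≥0∞ → ℝ≥0∞} (h : Monotone φ) (x : ℝ≥0∞) :
    2 * primitive φ (x / 2) ≤ primitive φ x := by
  have hm : Measurable fun y : ℝ => φ (ENNReal.ofReal y) :=
    h.measurable.comp ENNReal.measurable_ofReal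
  have hmap : volume = (2 : ℝ≥0∞) • Measure.map (fun y : ℝ => 2 * y) volume := by
    have := Real.smul_map_volume_mul_left (a := 2) two_ne_zero
    simpa using this.symm
  have hs : MeasurableSet {y : ℝ | 0 < y ∧ ENNReal.ofReal y < x} := measurableSet_pos_lt x
  have hs' := measurableSet_pos_lt (x / 2)
  have hind : ∀ (s : Set ℝ), MeasurableSet s → ∫⁻ y in s, φ (ENNReal.ofReal y) =
      2 * ∫⁻ y, s.indicator (fun y => φ (ENNReal.ofReal y)) (2 * y) := by
    intro s hs
    rw [← lintegral_indicator hs]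
    conv_lhs => rw [hmap]
    rw [lintegral_smul_measure, lintegral_map (hm.indicator hs) (by fun_prop), smul_eq_mul]
  rw [primitive, primitive, hind _ hs, ← lintegral_indicator hs']
  gcongr with y
  by_cases hy : y ∈ {y : ℝ | 0 < y ∧ ENNReal.ofReal y < x / 2}
  · have hy2 : 2 * y ∈ {y : ℝ | 0 < y ∧ ENNReal.ofReal y < x} := by
      refine ⟨mul_pos two_pos hy.1, ?_⟩
      have := (ENNReal.lt_div_iff_mul_lt (by simp) (by simp)).1 hy.2
      rw [ENNReal.ofReal_mul zero_le_two, ENNReal.ofReal_ofNat, mul_comm]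
      exact this
    rw [indicator_of_mem hy, indicator_of_mem hy2]
    exact h (ENNReal.ofReal_le_ofReal (by linarith [hy.1]))
  · rw [indicator_of_notMem hy]
    exact zero_le

/-! ### Distribution functions of measures without atoms -/

theorem continuous_measure_Iic (μ : Measure ℝ) [NullSingletonClass μ] (hfin : ∀ t, μ (Iic t) < ⊤) :
    Continuous fun t => μ (Iic t) := by
  have : IsLocallyFiniteMeasure μ := ⟨fun x => ⟨Iic (x + 1), Iic_mem_nhds (by linarith), hfin _⟩⟩
  refine continuous_iff_continuousAt.2 fun a => ?_
  rw [ContinuousAt, ENNReal.tendsto_nhds (hfin a).ne]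
  intro ε hε
  have h1 := (tendsto_measure_Icc (μ := μ) a).eventually (gt_mem_nhds hε)
  obtain ⟨r, hr0, hr⟩ := Metric.eventually_nhds_iff.1 h1
  have h2 : μ (Icc (a - r / 2) (a + r / 2)) < ε :=
    hr (by rw [Real.dist_eq, sub_zero, abs_of_pos (half_pos hr0)]; linarith)
  have h3 : ∀ s t : ℝ, a - r / 2 ≤ s → t ≤ a + r / 2 → μ (Iic t) ≤ μ (Iic s) + ε := by
    intro s t hs ht
    refine (measure_mono fun y hy => ?_).trans ((measure_union_le (Iic s) _).trans
      (add_le_add_right h2.le _))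
    rcases le_or_gt y s with hys | hys
    · exact Or.inl hys
    · exact Or.inr ⟨by linarith, le_trans hy ht⟩
  filter_upwards [Icc_mem_nhds (show a - r / 2 < a by linarith) (show a < a + r / 2 by linarith)]
    with t ht
  exact ⟨tsub_le_iff_right.2 (h3 t a ht.1 (by linarith)), h3 a t (by linarith) ht.2⟩

/-! ### The condition on the tails, for a general measure -/

/-- `y / μ(-∞, y]`. -/
noncomputable def ratio (μ : Measure ℝ) (y : ℝ) : ℝ≥0∞ :=
  ENNReal.ofReal y / μ (Iic y)

/-- `∫ₓ^∞ Φ(l/y) dμ(y)`, where `Φ` is the primitive of `φ`. -/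
noncomputable def tail (φ : ℝ≥0∞ → ℝ≥0∞) (μ : Measure ℝ) (l : ℝ≥0) (x : ℝ) : ℝ≥0∞ :=
  ∫⁻ y in Ioi x, primitive φ (l / ENNReal.ofReal y) ∂μ

/-- The analogue of `BetaCondition` for a measure, with a given constant. -/
noncomputable def TailCondition (φ : ℝ≥0∞ → ℝ≥0∞) (μ : Measure ℝ) (c : ℝ≥0) : Prop :=
  ∀ l : ℝ≥0, 0 < l → ∀ x : ℝ, 0 < x →
    ∫⁻ y in Iic x, inverse φ (c * tail φ μ l x / l * ratio μ y) * ratio μ y ∂μ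
      ≤ (c : ℝ≥0∞)⁻¹ * l

theorem monotone_measure_Iic (μ : Measure ℝ) : Monotone fun t => μ (Iic t) :=
  fun _ _ hab => measure_mono (Iic_subset_Iic.2 hab)

theorem measurable_ratio (μ : Measure ℝ) : Measurable (ratio μ) :=
  ENNReal.measurable_ofReal.div (monotone_measure_Iic μ).measurable

theorem tail_pos {φ : ℝ≥0∞ → ℝ≥0∞} (hφ : IsDensity φ) {μ : Measure ℝ}
    (hfin : ∀ t, μ (Iic t) < ⊤) (huniv : μ univ = ⊤) {l : ℝ≥0} (hl : 0 < l) (x : ℝ) :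
    0 < tail φ μ l x := by
  have hm : Measurable fun y : ℝ => primitive φ (l / ENNReal.ofReal y) :=
    (primitive_mono φ).measurable.comp (measurable_const.div ENNReal.measurable_ofReal)
  rw [tail, setLIntegral_pos_iff hm]
  have hsupp : Function.support (fun y : ℝ => primitive φ (l / ENNReal.ofReal y)) = univ := by
    refine eq_univ_of_forall fun y => (hφ.primitive_pos ?_).ne'
    exact ENNReal.div_pos (by exact_mod_cast hl.ne') ENNReal.ofReal_ne_top
  rw [hsupp, univ_inter, pos_iff_ne_zero]
  intro h
  have h1 := measure_union_le (μ := μ) (Iic x) (Ioi x)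
  rw [Iic_union_Ioi, huniv, h, add_zero] at h1
  exact absurd (hfin x) (not_lt.2 h1)

/-- If `U` vanished up to a last point `a > 0`, then just after `a` the ratio `y / U(y)` would be so
large that the integrand in the tail condition has integral at least a fixed positive amount over
every `(a, t]`. This contradicts the absolute continuity of a finite integral as `t` decreases to
`a`. -/
theorem TailCondition.measure_Iic_ne_zero {φ : ℝ≥0∞ → ℝ≥0∞} (hφ : IsDensity φ) {μ : Measure ℝ}
    [NullSingletonClass μ] (hfin : ∀ t, μ (Iic t) < ⊤) (huniv : μ univ = ⊤) {c : ℝ≥0}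
    (hc : 0 < c) (h : TailCondition φ μ c) {x : ℝ} (hx : 0 < x) : μ (Iic x) ≠ 0 := by
  intro hx0
  have hcont := continuous_measure_Iic μ hfin
  have hZc : IsClosed {t | μ (Iic t) = 0} := isClosed_eq hcont continuous_const
  have hZb : BddAbove {t | μ (Iic t) = 0} := by
    by_contra hb
    have h1 : ∀ t, μ (Iic t) = 0 := by
      intro t
      obtain ⟨s, hs, hts⟩ := not_bddAbove_iff.1 hb t
      exact measure_mono_null (Iic_subset_Iic.2 hts.le) hs
    have h2 := tendsto_measure_Iic_atTop μ
    simp only [h1] at h2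
    rw [tendsto_nhds_unique h2 tendsto_const_nhds] at huniv
    exact ENNReal.zero_ne_top huniv
  set a := sSup {t | μ (Iic t) = 0}
  have ha0 : μ (Iic a) = 0 := hZc.csSup_mem ⟨x, hx0⟩ hZb
  have ha : 0 < a := hx.trans_le (le_csSup hZb hx0)
  have hpos : ∀ t, a < t → μ (Iic t) ≠ 0 := fun t hat ht => absurd (le_csSup hZb ht) (not_le.2 hat)
  set b := a + 1
  have hab : a < b := lt_add_one a
  have hcond := h 1 one_pos b (ha.trans hab)
  set B : ℝ≥0∞ := c * tail φ μ 1 b / (1 : ℝ≥0)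
  have hB : B ≠ 0 := by
    have h1 : (c : ℝ≥0∞) ≠ 0 := by exact_mod_cast hc.ne'
    have h2 := (tail_pos hφ hfin huniv one_pos b).ne'
    simp [B, h1, h2]
  set f : ℝ → ℝ≥0∞ := fun y => inverse φ (B * ratio μ y) * ratio μ y
  set δ := inverse φ (B * (ENNReal.ofReal a / μ (Iic b)))
  have ha' : ENNReal.ofReal a ≠ 0 := (ENNReal.ofReal_pos.2 ha).ne'
  have hδ : δ ≠ 0 := by
    refine (hφ.inverse_pos (pos_iff_ne_zero.2 (mul_ne_zero hB ?_))).ne'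
    exact (ENNReal.div_pos ha' (hfin b).ne).ne'
  have hlow : ∀ t, a < t → t ≤ b →
      δ * ENNReal.ofReal a ≤ ∫⁻ y in Ioc a t, f y ∂(μ.restrict (Iic b)) := by
    intro t hat htb
    have hIoc : μ (Iic t) ≤ μ (Ioc a t) := by
      have := measure_union_le (μ := μ) (Iic a) (Ioc a t)
      rwa [Iic_union_Ioc_eq_Iic hat.le, ha0, zero_add] at this
    rw [Measure.restrict_restrict measurableSet_Ioc,
      inter_eq_left.2 (Ioc_subset_Iic_self.trans (Iic_subset_Iic.2 htb))]
    calc δ * ENNReal.ofReal a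
        = δ * (ENNReal.ofReal a / μ (Iic t)) * μ (Iic t) := by
          rw [mul_assoc, ENNReal.div_mul_cancel (hpos t hat) (hfin t).ne]
      _ ≤ δ * (ENNReal.ofReal a / μ (Iic t)) * μ (Ioc a t) := by gcongr
      _ = ∫⁻ _ in Ioc a t, δ * (ENNReal.ofReal a / μ (Iic t)) ∂μ := by rw [setLIntegral_const]
      _ ≤ ∫⁻ y in Ioc a t, f y ∂μ := by
          refine setLIntegral_mono' measurableSet_Ioc fun y hy => mul_le_mul' ?_ ?_
          · refine inverse_mono φ (mul_le_mul_right ?_ B)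
            exact ENNReal.div_le_div (ENNReal.ofReal_le_ofReal hy.1.le)
              (monotone_measure_Iic μ (hy.2.trans htb))
          · exact ENNReal.div_le_div (ENNReal.ofReal_le_ofReal hy.1.le)
              (monotone_measure_Iic μ hy.2)
  have hfin' : ∫⁻ y, f y ∂(μ.restrict (Iic b)) ≠ ⊤ := by
    refine (hcond.trans_lt (ENNReal.mul_lt_top ?_ ENNReal.coe_lt_top)).ne
    exact ENNReal.inv_lt_top.2 (by exact_mod_cast hc)
  have hlim : Tendsto (fun t => ∫⁻ y in Ioc a t, f y ∂(μ.restrict (Iic b))) (𝓝[>] a) (𝓝 0) := by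
    refine tendsto_setLIntegral_zero hfin' ?_
    have h1 : Tendsto (fun t => μ (Iic t)) (𝓝[>] a) (𝓝 0) := by
      have := (hcont.tendsto a).mono_left (nhdsWithin_le_nhds (s := Ioi a))
      rwa [ha0] at this
    refine tendsto_of_tendsto_of_tendsto_of_le_of_le tendsto_const_nhds h1 (fun _ => zero_le)
      fun t => ?_
    exact (Measure.restrict_apply_le _ _).trans (measure_mono Ioc_subset_Iic_self)
  have hle : δ * ENNReal.ofReal a ≤ 0 := by
    refine ge_of_tendsto hlim ?_
    filter_upwards [Ioc_mem_nhdsGT hab] with t ht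
    exact hlow t ht.1 ht.2
  exact mul_ne_zero hδ ha' (le_antisymm hle zero_le)

/-- An infinite tail would make the argument of `inverse φ` infinite on all of `(0, x]`, a set of
positive mass, so the left side of the tail condition would be infinite. -/
theorem TailCondition.tail_ne_top {φ : ℝ≥0∞ → ℝ≥0∞} (hφ : IsDensity φ) {μ : Measure ℝ}
    (h0 : μ (Iic 0) = 0) (hfin : ∀ t, μ (Iic t) < ⊤)
    {c : ℝ≥0} (hc : 0 < c) (h : TailCondition φ μ c) {l : ℝ≥0} (hl : 0 < l)
    {x : ℝ} (hx : 0 < x) (hpos : μ (Iic x) ≠ 0) : tail φ μ l x ≠ ⊤ := by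
  intro htop
  have hcond := h l hl x hx
  have hc' : (c : ℝ≥0∞) ≠ 0 := by exact_mod_cast hc.ne'
  rw [htop, ENNReal.mul_top hc', ENNReal.top_div_coe] at hcond
  have hratio : ∀ y, 0 < y → ratio μ y ≠ 0 := fun y hy =>
    (ENNReal.div_pos (ENNReal.ofReal_pos.2 hy).ne' (hfin y).ne).ne'
  have hIoc : μ (Iic x) ≤ μ (Ioc 0 x) := by
    have := measure_union_le (μ := μ) (Iic 0) (Ioc 0 x)
    rwa [Iic_union_Ioc_eq_Iic hx.le, h0, zero_add] at this
  have h1 : (⊤ : ℝ≥0∞) ≤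
      ∫⁻ y in Iic x, inverse φ (⊤ * ratio μ y) * ratio μ y ∂μ := by
    calc (⊤ : ℝ≥0∞) = ⊤ * μ (Ioc 0 x) := by
          rw [ENNReal.top_mul]
          exact fun h => hpos (le_antisymm (hIoc.trans h.le) zero_le)
      _ = ∫⁻ _ in Ioc 0 x, ⊤ ∂μ := by rw [setLIntegral_const]
      _ ≤ ∫⁻ y in Ioc 0 x, inverse φ (⊤ * ratio μ y) * ratio μ y ∂μ := by
          refine setLIntegral_mono' measurableSet_Ioc fun y hy => ?_
          rw [ENNReal.top_mul (hratio y hy.1), hφ.inverse_top, ENNReal.top_mul (hratio y hy.1)]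
      _ ≤ _ := lintegral_mono_set Ioc_subset_Iic_self
  refine absurd (h1.trans hcond) (not_le.2 (ENNReal.mul_lt_top ?_ ENNReal.coe_lt_top))
  exact ENNReal.inv_lt_top.2 (by exact_mod_cast hc)

/-! ### A modular inequality of Hardy type -/

/-- `∫ G(y) (y / μ(-∞, y]) dμ(y)` over `(-∞, t]`. -/
noncomputable def ratioIntegral (μ : Measure ℝ) (G : ℝ → ℝ≥0∞) (t : ℝ) : ℝ≥0∞ :=
  ∫⁻ y in Iic t, ratio μ y * G y ∂μ

theorem ratioIntegral_mono (μ : Measure ℝ) (G : ℝ → ℝ≥0∞) : Monotone (ratioIntegral μ G) :=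
  fun _ _ hab => lintegral_mono_set (Iic_subset_Iic.2 hab)

/-- Young's inequality for `G(y)` and `B * ratio μ y`, integrated over `S`, where `B = c * tail φ μ
l x / l`. This `B` is the multiplier for which the tail condition bounds the dual term. -/
theorem TailCondition.mul_setLIntegral_le {φ : ℝ≥0∞ → ℝ≥0∞} (hφ : IsDensity φ) {μ : Measure ℝ}
    {c : ℝ≥0} (h : TailCondition φ μ c)
    {G : ℝ → ℝ≥0∞} (hG : Measurable G) {l : ℝ≥0} (hl : 0 < l) {x : ℝ} (hx : 0 < x)
    {S : Set ℝ} (hS : S ⊆ Iic x) :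
    c * tail φ μ l x / l * ∫⁻ y in S, ratio μ y * G y ∂μ ≤
      ∫⁻ y in S, primitive φ (G y) ∂μ + c * tail φ μ l x / l * ((c : ℝ≥0∞)⁻¹ * l) := by
  set B := c * tail φ μ l x / l with hB
  have hr := measurable_ratio μ
  have hi : Measurable fun y => inverse φ (B * ratio μ y) * ratio μ y :=
    ((inverse_mono φ).measurable.comp (hr.const_mul B)).mul hr
  have hp : Measurable fun y => primitive φ (G y) := (primitive_mono φ).measurable.comp hG
  calc B * ∫⁻ y in S, ratio μ y * G y ∂μ = ∫⁻ y in S, B * (ratio μ y * G y) ∂μ :=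
        (lintegral_const_mul B (hr.mul hG)).symm
    _ ≤ ∫⁻ y in S, (primitive φ (G y) + B * (inverse φ (B * ratio μ y) * ratio μ y)) ∂μ := by
        refine lintegral_mono fun y => ?_
        refine (le_of_eq ?_).trans
          ((mul_le_primitive_add hφ.1 (G y) (B * ratio μ y)).trans (le_of_eq ?_)) <;> ring
    _ = ∫⁻ y in S, primitive φ (G y) ∂μ +
          B * ∫⁻ y in S, inverse φ (B * ratio μ y) * ratio μ y ∂μ := by
        rw [lintegral_add_left hp, lintegral_const_mul B hi]
    _ ≤ _ := by
        gcongr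
        exact (lintegral_mono_set hS).trans (h l hl x hx)

theorem TailCondition.ratioIntegral_lt_top {φ : ℝ≥0∞ → ℝ≥0∞} (hφ : IsDensity φ) {μ : Measure ℝ}
    [NullSingletonClass μ] (h0 : μ (Iic 0) = 0) (hfin : ∀ t, μ (Iic t) < ⊤) (huniv : μ univ = ⊤)
    {c : ℝ≥0} (hc : 0 < c) (h : TailCondition φ μ c) {G : ℝ → ℝ≥0∞} (hG : Measurable G)
    (hGfin : ∫⁻ y, primitive φ (G y) ∂μ ≠ ⊤) (t : ℝ) : ratioIntegral μ G t < ⊤ := by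
  wlog ht : 0 < t generalizing t
  · exact (ratioIntegral_mono μ G (show t ≤ 1 by linarith)).trans_lt (this 1 one_pos)
  have h1 := h.mul_setLIntegral_le hφ hG one_pos ht (Subset.refl (Iic t))
  have hc' : (c : ℝ≥0∞) ≠ 0 := by exact_mod_cast hc.ne'
  have hB0 : c * tail φ μ 1 t / (1 : ℝ≥0) ≠ 0 := by
    have h2 := (tail_pos hφ hfin huniv one_pos t).ne'
    simp [hc', h2]
  have hBt : c * tail φ μ 1 t / (1 : ℝ≥0) ≠ ⊤ := by
    have h2 := h.tail_ne_top hφ h0 hfin hc one_pos ht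
      (h.measure_Iic_ne_zero hφ hfin huniv hc ht)
    simpa using ENNReal.mul_ne_top ENNReal.coe_ne_top h2
  refine lt_of_mul_lt_mul_left' (a := c * tail φ μ 1 t / (1 : ℝ≥0)) (h1.trans_lt ?_)
  rw [ENNReal.mul_top hB0, ENNReal.add_lt_top]
  refine ⟨((setLIntegral_le_lintegral _ _).trans_lt hGfin.lt_top), ?_⟩
  exact ENNReal.mul_lt_top hBt.lt_top (ENNReal.mul_lt_top
    (ENNReal.inv_lt_top.2 (by exact_mod_cast hc)) ENNReal.coe_lt_top)

theorem continuous_ratioIntegral {μ : Measure ℝ} [NullSingletonClass μ] {G : ℝ → ℝ≥0∞}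
    (hfin : ∀ t, ratioIntegral μ G t < ⊤) : Continuous (ratioIntegral μ G) := by
  have h1 : ∀ t, μ.withDensity (fun y => ratio μ y * G y) (Iic t) = ratioIntegral μ G t :=
    fun t => withDensity_apply _ measurableSet_Iic
  have : NullSingletonClass (μ.withDensity fun y => ratio μ y * G y) :=
    ⟨fun x => withDensity_absolutelyContinuous μ _ (measure_singleton x)⟩
  have h2 := continuous_measure_Iic (μ.withDensity fun y => ratio μ y * G y)
    fun t => (h1 t).trans_lt (hfin t)
  simpa only [h1] using h2

/-- Continuity makes the superlevel set a closed half-line with the value `v` attained exactly at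
its left end; `F 0 = 0 < v` keeps that end positive. -/
theorem exists_first_ge {F : ℝ → ℝ≥0∞} (hF : Continuous F) (hmono : Monotone F)
    (h0 : F 0 = 0) {v : ℝ≥0∞} (hv : 0 < v) {y : ℝ} (hy : v ≤ F y) :
    ∃ x, 0 < x ∧ F x = v ∧ ∀ t, v ≤ F t ↔ x ≤ t := by
  have hclosed : IsClosed {t | v ≤ F t} := isClosed_le continuous_const hF
  have hpos : ∀ t, v ≤ F t → 0 < t := by
    intro t ht
    by_contra hneg
    exact absurd (hv.trans_le (ht.trans (hmono (not_lt.1 hneg)))) (by simp [h0])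
  have hb : BddBelow {t | v ≤ F t} := ⟨0, fun t ht => (hpos t ht).le⟩
  have hmem : v ≤ F (sInf {t | v ≤ F t}) := hclosed.csInf_mem ⟨y, hy⟩ hb
  refine ⟨sInf {t | v ≤ F t}, hpos _ hmem, le_antisymm ?_ hmem,
    fun t => ⟨fun ht => csInf_le hb ht, fun ht => hmem.trans (hmono ht)⟩⟩
  refine le_of_tendsto ((hF.tendsto _).mono_left (nhdsWithin_le_nhds (s := Iio (sInf {t | v ≤ F t})))) ?_
  filter_upwards [self_mem_nhdsWithin] with t ht
  by_contra hlt
  exact absurd (csInf_le hb (not_le.1 hlt).le) (not_le.2 ht)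

theorem TailCondition.tail_le {φ : ℝ≥0∞ → ℝ≥0∞} (hφ : IsDensity φ) {μ : Measure ℝ}
    (h0 : μ (Iic 0) = 0) (hfin : ∀ t, μ (Iic t) < ⊤)
    {c : ℝ≥0} (hc : 0 < c) (h : TailCondition φ μ c) {G : ℝ → ℝ≥0∞} (hG : Measurable G)
    {x : ℝ} (hx : 0 < x) (hpos : μ (Iic x) ≠ 0) {S : Set ℝ} (hS : S ⊆ Iic x) {a : ℝ≥0}
    (ha : 0 < a) (hSa : a ≤ ∫⁻ y in S, ratio μ y * G y ∂μ) :
    tail φ μ (c * a / 2) x ≤ ∫⁻ y in S, primitive φ (G y) ∂μ := by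
  -- With `l = c * a / 2` the left side of Young's inequality is at least `2T` and the dual term is
  -- exactly `T`, where `T` is the tail. The finiteness of `T` then permits cancellation.
  have hl : 0 < c * a / 2 := by positivity
  have h1 := h.mul_setLIntegral_le hφ hG hl hx hS
  have h2 := h.tail_ne_top hφ h0 hfin hc hl hx hpos
  set T := tail φ μ (c * a / 2) x
  have hc' : (c : ℝ≥0∞) ≠ 0 := by exact_mod_cast hc.ne'
  have ha' : (a : ℝ≥0∞) ≠ 0 := by exact_mod_cast ha.ne'
  lift T to ℝ≥0 using h2 with T'
  have hB : (c : ℝ≥0∞) * T' / (c * a / 2 : ℝ≥0) = (2 * T' / a : ℝ≥0) := by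
    rw [← ENNReal.coe_mul, ← ENNReal.coe_div hl.ne']
    congr 1
    field_simp
  rw [hB, ← ENNReal.coe_inv hc.ne', ← ENNReal.coe_mul, ← ENNReal.coe_mul] at h1
  have h3 : ((2 * T' / a : ℝ≥0) : ℝ≥0∞) * a ≤
      ∫⁻ y in S, primitive φ (G y) ∂μ + (2 * T' / a * (c⁻¹ * (c * a / 2)) : ℝ≥0) :=
    (mul_le_mul_right hSa _).trans h1
  have h4 : 2 * T' / a * a = T' + T' := by field_simp; ring
  have h5 : 2 * T' / a * (c⁻¹ * (c * a / 2)) = T' := by field_simp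
  rw [← ENNReal.coe_mul, h4, h5, ENNReal.coe_add] at h3
  exact (ENNReal.add_le_add_iff_right ENNReal.coe_ne_top).1 h3

/-- Where `2a ≤ F < 4a`, the argument of `Φ` is at most `(c * a / 2) / y`, and such `y` lie beyond
the point `x` where `F` reaches `2a`. The integral is therefore at most a tail, which is paid for by
the preceding level, over which `F` gains `a`. -/
theorem TailCondition.lintegral_level_le {φ : ℝ≥0∞ → ℝ≥0∞} (hφ : IsDensity φ) {μ : Measure ℝ}
    [NullSingletonClass μ] (h0 : μ (Iic 0) = 0) (hfin : ∀ t, μ (Iic t) < ⊤) (huniv : μ univ = ⊤)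
    {c : ℝ≥0} (hc : 0 < c) (h : TailCondition φ μ c) {G : ℝ → ℝ≥0∞} (hG : Measurable G)
    (hcont : Continuous (ratioIntegral μ G)) {a : ℝ≥0} (ha : 0 < a) :
    ∫⁻ y in ratioIntegral μ G ⁻¹' Ico (2 * a) (4 * a),
        primitive φ (c / 8 * (ratioIntegral μ G y / ENNReal.ofReal y)) ∂μ ≤
      ∫⁻ y in ratioIntegral μ G ⁻¹' Ico a (2 * a), primitive φ (G y) ∂μ := by
  set F := ratioIntegral μ G with hF
  have hmono : Monotone F := ratioIntegral_mono μ G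
  have hF0 : F 0 = 0 := by
    rw [hF, ratioIntegral, Measure.restrict_eq_zero.2 h0, lintegral_zero_measure]
  rcases (F ⁻¹' Ico (2 * a : ℝ≥0∞) (4 * a)).eq_empty_or_nonempty with he | ⟨y₀, hy₀⟩
  · rw [he, Measure.restrict_empty, lintegral_zero_measure]
    exact zero_le
  have ha' : (0 : ℝ≥0∞) < a := by exact_mod_cast ha
  have haa : (a : ℝ≥0∞) ≤ 2 * a := by rw [two_mul]; exact le_self_add
  obtain ⟨x, hx, hFx, hxt⟩ := exists_first_ge hcont hmono hF0 (ha'.trans_le haa) hy₀.1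
  obtain ⟨z, hz, hFz, hzt⟩ := exists_first_ge hcont hmono hF0 ha' (haa.trans hy₀.1)
  have hSa : (a : ℝ≥0∞) ≤ ∫⁻ y in F ⁻¹' Ico (a : ℝ≥0∞) (2 * a) ∩ Iic x, ratio μ y * G y ∂μ := by
    -- The total `F x = 2a` splits at `z`: the part up to `z` contributes `a`, so the level set
    -- contributes at least `a`.
    have h1 : (a : ℝ≥0∞) + a ≤
        a + ∫⁻ y in F ⁻¹' Ico (a : ℝ≥0∞) (2 * a) ∩ Iic x, ratio μ y * G y ∂μ := by
      calc (a : ℝ≥0∞) + a = ∫⁻ y in Iio x, ratio μ y * G y ∂μ := by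
            rw [← two_mul, ← hFx, hF, ratioIntegral, setLIntegral_congr Iio_ae_eq_Iic]
        _ ≤ ∫⁻ y in Iic z ∪ (F ⁻¹' Ico (a : ℝ≥0∞) (2 * a) ∩ Iic x), ratio μ y * G y ∂μ := by
            refine lintegral_mono_set fun y hy => ?_
            rcases le_or_gt y z with hyz | hyz
            · exact Or.inl hyz
            · refine Or.inr ⟨⟨(hzt y).2 hyz.le, ?_⟩, (mem_Iio.1 hy).le⟩
              exact not_le.1 fun hle => absurd ((hxt y).1 hle) (not_le.2 hy)
        _ ≤ F z + _ := lintegral_union_le _ _ _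
        _ = _ := by rw [hFz]
    exact (ENNReal.add_le_add_iff_left ENNReal.coe_ne_top).1 h1
  have h1 := h.tail_le hφ h0 hfin hc hG hx (h.measure_Iic_ne_zero hφ hfin huniv hc hx)
    inter_subset_right ha hSa
  calc ∫⁻ y in F ⁻¹' Ico (2 * a : ℝ≥0∞) (4 * a), primitive φ (c / 8 * (F y / ENNReal.ofReal y)) ∂μ
      ≤ ∫⁻ y in F ⁻¹' Ico (2 * a : ℝ≥0∞) (4 * a),
          primitive φ ((c * a / 2 : ℝ≥0) / ENNReal.ofReal y) ∂μ := by
        refine setLIntegral_mono' (hcont.measurable measurableSet_Ico) fun y hy => ?_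
        refine primitive_mono φ ?_
        rw [← mul_div_assoc]
        refine ENNReal.div_le_div_right ?_ _
        refine (mul_le_mul_right hy.2.le _).trans (le_of_eq ?_)
        have : (c : ℝ≥0∞) / 8 * (4 * a) = ((c / 8 * (4 * a) : ℝ≥0) : ℝ≥0∞) := by
          push_cast
          rw [ENNReal.coe_div (by norm_num)]
          norm_cast
        rw [this]
        congr 1
        field_simp
        norm_num
    _ ≤ ∫⁻ y in Ici x, primitive φ ((c * a / 2 : ℝ≥0) / ENNReal.ofReal y) ∂μ :=
        lintegral_mono_set fun y hy => (hxt y).1 hy.1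
    _ = tail φ μ (c * a / 2) x := setLIntegral_congr Ioi_ae_eq_Ici.symm
    _ ≤ _ := h1
    _ ≤ _ := lintegral_mono_set inter_subset_left

theorem TailCondition.lintegral_hardy_le {φ : ℝ≥0∞ → ℝ≥0∞} (hφ : IsDensity φ) {μ : Measure ℝ}
    [NullSingletonClass μ] (h0 : μ (Iic 0) = 0) (hfin : ∀ t, μ (Iic t) < ⊤) (huniv : μ univ = ⊤)
    {c : ℝ≥0} (hc : 0 < c) (h : TailCondition φ μ c) {G : ℝ → ℝ≥0∞} (hG : Measurable G) :
    ∫⁻ y, primitive φ (c / 8 * (ratioIntegral μ G y / ENNReal.ofReal y)) ∂μ ≤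
      ∫⁻ y, primitive φ (G y) ∂μ := by
  by_cases hGfin : ∫⁻ y, primitive φ (G y) ∂μ = ⊤
  · rw [hGfin]
    exact le_top
  have hFfin := h.ratioIntegral_lt_top hφ h0 hfin huniv hc hG hGfin
  have hcont := continuous_ratioIntegral hFfin
  have hlev : ∀ j : ℤ, ∫⁻ y in ratioIntegral μ G ⁻¹' Ico ((2 : ℝ≥0∞) ^ (j + 1)) (2 ^ (j + 1 + 1)),
        primitive φ (c / 8 * (ratioIntegral μ G y / ENNReal.ofReal y)) ∂μ ≤
      ∫⁻ y in ratioIntegral μ G ⁻¹' Ico ((2 : ℝ≥0∞) ^ j) (2 ^ (j + 1)), primitive φ (G y) ∂μ := by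
    intro j
    have h1 := h.lintegral_level_le hφ h0 hfin huniv hc hG hcont
      (a := 2 ^ j) (zpow_pos two_pos j)
    have h2 : (((2 : ℝ≥0) ^ j : ℝ≥0) : ℝ≥0∞) = 2 ^ j := by
      rw [ENNReal.coe_zpow two_ne_zero, ENNReal.coe_ofNat]
    have h3 : ∀ i : ℤ, (2 : ℝ≥0∞) ^ (i + 1) = 2 * 2 ^ i := fun i => by
      rw [ENNReal.zpow_add two_ne_zero ENNReal.ofNat_ne_top, zpow_one, mul_comm]
    have h4 : (4 : ℝ≥0∞) * 2 ^ j = 2 ^ (j + 1 + 1) := by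
      rw [h3, h3, ← mul_assoc]
      norm_num
    rwa [h2, h4, ← h3] at h1
  set F := ratioIntegral μ G
  set S : ℤ → Set ℝ := fun j => F ⁻¹' Ico ((2 : ℝ≥0∞) ^ j) (2 ^ (j + 1)) with hSdef
  have hSm : ∀ j, MeasurableSet (S j) := fun j => hcont.measurable measurableSet_Ico
  have hSd : Pairwise (Function.onFun Disjoint S) := by
    intro i j hij
    refine Disjoint.preimage _ (Set.disjoint_left.2 fun v hvi hvj => hij ?_)
    have hm : ∀ m n : ℤ, (2 : ℝ≥0∞) ^ m < 2 ^ (n + 1) → m ≤ n := fun m n hmn => by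
      by_contra hlt
      refine absurd hmn (not_lt.2 (ENNReal.zpow_le_of_le (by norm_num) ?_))
      omega
    exact le_antisymm (hm i j (hvi.1.trans_lt hvj.2)) (hm j i (hvj.1.trans_lt hvi.2))
  have hcover : (univ : Set ℝ) ⊆ F ⁻¹' {0} ∪ ⋃ j, S j := by
    intro y _
    by_cases hy : F y = 0
    · exact Or.inl hy
    · obtain ⟨n, hn⟩ := ENNReal.exists_mem_Ico_zpow hy (hFfin y).ne
        (show (1 : ℝ≥0∞) < 2 by norm_num) (by simp)
      exact Or.inr (mem_iUnion.2 ⟨n, hn⟩)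
  calc ∫⁻ y, primitive φ (c / 8 * (F y / ENNReal.ofReal y)) ∂μ
      ≤ ∫⁻ y in F ⁻¹' {0} ∪ ⋃ j, S j, primitive φ (c / 8 * (F y / ENNReal.ofReal y)) ∂μ := by
        rw [← setLIntegral_univ]
        exact lintegral_mono_set hcover
    _ ≤ ∫⁻ y in F ⁻¹' {0}, primitive φ (c / 8 * (F y / ENNReal.ofReal y)) ∂μ +
          ∫⁻ y in ⋃ j, S j, primitive φ (c / 8 * (F y / ENNReal.ofReal y)) ∂μ :=
        lintegral_union_le _ _ _
    _ ≤ 0 + ∑' j, ∫⁻ y in S j, primitive φ (c / 8 * (F y / ENNReal.ofReal y)) ∂μ := by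
        refine add_le_add (le_of_eq ?_) (lintegral_iUnion_le _ _)
        refine (setLIntegral_congr_fun (hcont.measurable (measurableSet_singleton 0))
          fun y hy => ?_).trans lintegral_zero
        have : F y = 0 := hy
        simp [this, primitive_zero]
    -- Shifting the index pairs each level on the left with the preceding level on the right.
    _ = ∑' j, ∫⁻ y in S (j + 1), primitive φ (c / 8 * (F y / ENNReal.ofReal y)) ∂μ := by
        rw [zero_add]
        exact ((Equiv.addRight (1 : ℤ)).tsum_eq _).symm
    _ ≤ ∑' j, ∫⁻ y in S j, primitive φ (G y) ∂μ := ENNReal.tsum_le_tsum hlev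
    _ = ∫⁻ y in ⋃ j, S j, primitive φ (G y) ∂μ := (lintegral_iUnion hSm hSd _).symm
    _ ≤ ∫⁻ y, primitive φ (G y) ∂μ := setLIntegral_le_lintegral _ _

/-! ### Halving the mass -/

/-- The least point at which `μ(-∞, ·]` reaches half of `μ(-∞, y]`. -/
noncomputable def halfPoint (μ : Measure ℝ) (y : ℝ) : ℝ :=
  sInf {s | μ (Iic y) / 2 ≤ μ (Iic s)}

theorem halfPoint_le_iff {μ : Measure ℝ} [NullSingletonClass μ] (h0 : μ (Iic 0) = 0)
    (hfin : ∀ t, μ (Iic t) < ⊤) {y : ℝ} (hpos : μ (Iic y) ≠ 0) (a : ℝ) :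
    halfPoint μ y ≤ a ↔ μ (Iic y) / 2 ≤ μ (Iic a) := by
  obtain ⟨x, -, -, hx⟩ := exists_first_ge (continuous_measure_Iic μ hfin)
    (monotone_measure_Iic μ) h0 (ENNReal.half_pos hpos) (y := y) ENNReal.half_le_self
  have : {s | μ (Iic y) / 2 ≤ μ (Iic s)} = Ici x := Set.ext hx
  rw [halfPoint, this, csInf_Ici, hx]

theorem halfPoint_mono {μ : Measure ℝ} [NullSingletonClass μ] (h0 : μ (Iic 0) = 0)
    (hfin : ∀ t, μ (Iic t) < ⊤) : Monotone (halfPoint μ) := by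
  intro a b hab
  -- Here the defining set is all of `ℝ`, whose `sInf` is 0 by convention.
  have hz : ∀ y, μ (Iic y) = 0 → halfPoint μ y = 0 := fun y hy => by
    simp [halfPoint, hy]
  by_cases hb : μ (Iic b) = 0
  · rw [hz b hb, hz a (measure_mono_null (Iic_subset_Iic.2 hab) hb)]
  · have hhb := (halfPoint_le_iff h0 hfin hb _).1 le_rfl
    by_cases ha : μ (Iic a) = 0
    · rw [hz a ha]
      by_contra hneg
      refine absurd ((ENNReal.half_pos hb).trans_le hhb) (not_lt.2 ?_)
      exact (measure_mono_null (Iic_subset_Iic.2 (not_le.1 hneg).le) h0).le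
    · rw [halfPoint_le_iff h0 hfin ha]
      exact (ENNReal.div_le_div_right (monotone_measure_Iic μ hab) 2).trans hhb

/-- `U` transports `μ` to Lebesgue measure: the set is the half-line ending at the last point where
`U ≤ v`, and `U` takes the value `v` there because it is continuous and unbounded. -/
theorem measure_setOf_measure_Iic_le {μ : Measure ℝ} [NullSingletonClass μ] (h0 : μ (Iic 0) = 0)
    (hfin : ∀ t, μ (Iic t) < ⊤) (huniv : μ univ = ⊤) {v : ℝ≥0∞} (hv : v < ⊤) :
    μ {y | μ (Iic y) ≤ v} = v := by
  have hcont := continuous_measure_Iic μ hfin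
  have hlim := tendsto_measure_Iic_atTop μ
  rw [huniv] at hlim
  obtain ⟨z, hz⟩ := (hlim.eventually (lt_mem_nhds hv)).exists
  have hb : BddAbove {y | μ (Iic y) ≤ v} := by
    refine ⟨z, fun y hy => ?_⟩
    by_contra hlt
    exact absurd (hz.trans_le ((monotone_measure_Iic μ (not_le.1 hlt).le).trans hy)) (lt_irrefl v)
  have hm : μ (Iic (sSup {y | μ (Iic y) ≤ v})) ≤ v :=
    (isClosed_le hcont continuous_const).csSup_mem ⟨0, h0.le.trans zero_le⟩ hb
  have heq : {y | μ (Iic y) ≤ v} = Iic (sSup {y | μ (Iic y) ≤ v}) :=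
    Set.ext fun y => ⟨fun hy => le_csSup hb hy, fun hy => (monotone_measure_Iic μ hy).trans hm⟩
  rw [heq]
  refine le_antisymm hm ?_
  rcases eq_or_ne v 0 with rfl | hv0
  · exact zero_le
  · obtain ⟨x, -, hx, -⟩ := exists_first_ge hcont (monotone_measure_Iic μ) h0
      (pos_iff_ne_zero.2 hv0) hz.le
    refine hx.ge.trans (monotone_measure_Iic μ (le_csSup hb ?_))
    exact hx.le

theorem ae_pos_of_measure_Iic_zero {μ : Measure ℝ} (h0 : μ (Iic 0) = 0) : ∀ᵐ y ∂μ, 0 < y := by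
  have : {y : ℝ | ¬ 0 < y} = Iic 0 := by
    ext y
    simp
  rw [ae_iff, this, h0]

/-- For almost every `y`, `halfPoint μ y ≤ a` says that `U(y) ≤ 2 U(a)`, a set of mass `2 U(a)`.
Half-lines determine the measure. -/
theorem map_halfPoint {μ : Measure ℝ} [NullSingletonClass μ] (h0 : μ (Iic 0) = 0)
    (hfin : ∀ t, μ (Iic t) < ⊤) (huniv : μ univ = ⊤) (hpos : ∀ x, 0 < x → μ (Iic x) ≠ 0) :
    μ.map (halfPoint μ) = (2 : ℝ≥0∞) • μ := by
  have hm := (halfPoint_mono h0 hfin).measurable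
  have key : ∀ a, μ.map (halfPoint μ) (Iic a) = ((2 : ℝ≥0∞) • μ) (Iic a) := by
    intro a
    have h2 : 2 * μ (Iic a) < ⊤ := ENNReal.mul_lt_top (by simp) (hfin a)
    rw [Measure.map_apply hm measurableSet_Iic, Measure.smul_apply, smul_eq_mul,
      ← measure_setOf_measure_Iic_le h0 hfin huniv h2]
    refine measure_congr ?_
    filter_upwards [ae_pos_of_measure_Iic_zero h0] with y hy
    refine propext ((halfPoint_le_iff h0 hfin (hpos y hy) a).trans ?_)
    rw [ENNReal.div_le_iff two_ne_zero ENNReal.ofNat_ne_top, mul_comm]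
    exact Iff.rfl
  refine Measure.ext_of_generateFrom_of_iUnion (range Iic) (fun n : ℕ => Iic (n : ℝ))
    (BorelSpace.measurable_eq.trans (borel_eq_generateFrom_Iic ℝ)) isPiSystem_Iic ?_
    (fun n => mem_range_self _) (fun n => ?_) ?_
  · refine eq_univ_of_forall fun y => mem_iUnion.2 ?_
    obtain ⟨n, hn⟩ := exists_nat_ge y
    exact ⟨n, hn⟩
  · rw [key, Measure.smul_apply, smul_eq_mul]
    exact ENNReal.mul_ne_top ENNReal.ofNat_ne_top (hfin _).ne
  · rintro _ ⟨a, rfl⟩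
    exact key a

theorem lintegral_comp_halfPoint {μ : Measure ℝ} [NullSingletonClass μ] (h0 : μ (Iic 0) = 0)
    (hfin : ∀ t, μ (Iic t) < ⊤) (huniv : μ univ = ⊤) (hpos : ∀ x, 0 < x → μ (Iic x) ≠ 0)
    {H : ℝ → ℝ≥0∞} (hH : Measurable H) :
    ∫⁻ y, H (halfPoint μ y) ∂μ = 2 * ∫⁻ y, H y ∂μ := by
  rw [← lintegral_map hH (halfPoint_mono h0 hfin).measurable,
    map_halfPoint h0 hfin huniv hpos, lintegral_smul_measure, smul_eq_mul]

/-! ### Averages of nonincreasing functions -/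

/-- If `U(t) ≤ 2 U(s)`, then `halfPoint μ t ≤ s` and the last term suffices. Otherwise let `U(z) = 2
U(s)`: on `(s, z]`, of mass at least `U(s)`, the half point is at most `s`, so the integrand is at
least `g s / (2 U(s))` and twice its integral is at least `g s`. -/
theorem antitone_le_add {μ : Measure ℝ} [NullSingletonClass μ] (h0 : μ (Iic 0) = 0)
    (hfin : ∀ t, μ (Iic t) < ⊤) (hpos : ∀ x, 0 < x → μ (Iic x) ≠ 0)
    {g : ℝ → ℝ≥0∞} (hg : Antitone g) {s t : ℝ} (hs : 0 < s) (hst : s ≤ t) :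
    g s ≤ 2 * ∫⁻ y in Ioc s t, g (halfPoint μ y) / μ (Iic y) ∂μ + g (halfPoint μ t) := by
  by_cases hhalf : μ (Iic t) / 2 ≤ μ (Iic s)
  · exact (hg ((halfPoint_le_iff h0 hfin (hpos t (hs.trans_le hst)) s).2 hhalf)).trans le_add_self
  have hs0 := hpos s hs
  have hsf := (hfin s).ne
  have hv0 : 2 * μ (Iic s) ≠ 0 := mul_ne_zero two_ne_zero hs0
  have hvf : 2 * μ (Iic s) ≠ ⊤ := ENNReal.mul_ne_top ENNReal.ofNat_ne_top hsf
  have hvt : 2 * μ (Iic s) ≤ μ (Iic t) := by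
    have := (ENNReal.lt_div_iff_mul_lt (by simp) (by simp)).1 (not_le.1 hhalf)
    rw [mul_comm]
    exact this.le
  obtain ⟨z, hz, hzv, hzt⟩ := exists_first_ge (continuous_measure_Iic μ hfin)
    (monotone_measure_Iic μ) h0 (pos_iff_ne_zero.2 hv0) hvt
  have hsz : s ≤ z := by
    by_contra hlt
    have h1 : 2 * μ (Iic s) ≤ 1 * μ (Iic s) := by
      rw [one_mul, ← hzv]
      exact monotone_measure_Iic μ (not_le.1 hlt).le
    exact absurd ((ENNReal.mul_le_mul_iff_left hs0 hsf).1 h1) (by norm_num)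
  have hmass : μ (Iic s) ≤ μ (Ioc s z) := by
    have h1 := measure_union_le (μ := μ) (Iic s) (Ioc s z)
    rw [Iic_union_Ioc_eq_Iic hsz, hzv, two_mul] at h1
    exact (ENNReal.add_le_add_iff_left hsf).1 h1
  refine le_trans ?_ le_self_add
  calc g s = 2 * (g s / (2 * μ (Iic s)) * μ (Iic s)) := by
        rw [mul_left_comm, ENNReal.div_mul_cancel hv0 hvf]
    _ ≤ 2 * (g s / (2 * μ (Iic s)) * μ (Ioc s z)) := by gcongr
    _ = 2 * ∫⁻ _ in Ioc s z, g s / (2 * μ (Iic s)) ∂μ := by rw [setLIntegral_const]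
    _ ≤ 2 * ∫⁻ y in Ioc s z, g (halfPoint μ y) / μ (Iic y) ∂μ := by
        gcongr 2 * ?_
        refine setLIntegral_mono' measurableSet_Ioc fun y hy => ?_
        have hyv : μ (Iic y) ≤ 2 * μ (Iic s) := hzv ▸ monotone_measure_Iic μ hy.2
        refine ENNReal.div_le_div (hg ?_) hyv
        rw [halfPoint_le_iff h0 hfin (hpos y (hs.trans hy.1)),
          ENNReal.div_le_iff two_ne_zero ENNReal.ofNat_ne_top, mul_comm]
        exact hyv
    _ ≤ _ := by
        gcongr 2 * ?_
        exact lintegral_mono_set (Ioc_subset_Ioc_right ((hzt t).1 hvt))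

/-- Tonelli on `0 < s < y ≤ t`: the `s`-section has length `y`, the factor that turns `1 / U(y)`
into `ratio μ y`. -/
theorem lintegral_Ioo_lintegral_Ioc_le {μ : Measure ℝ} [SFinite μ] {H : ℝ → ℝ≥0∞}
    (hH : Measurable H) (t : ℝ) :
    ∫⁻ s in Ioo 0 t, ∫⁻ y in Ioc s t, H y ∂μ ≤ ∫⁻ y in Iic t, ENNReal.ofReal y * H y ∂μ := by
  set D : Set (ℝ × ℝ) := {p | 0 < p.1 ∧ p.1 < p.2 ∧ p.2 ≤ t}
  have hD : MeasurableSet D :=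
    (measurableSet_lt measurable_const measurable_fst).inter
      ((measurableSet_lt measurable_fst measurable_snd).inter
        (measurableSet_le measurable_snd measurable_const))
  have hm : Measurable (D.indicator fun p => H p.2) := (hH.comp measurable_snd).indicator hD
  calc ∫⁻ s in Ioo 0 t, ∫⁻ y in Ioc s t, H y ∂μ
      = ∫⁻ s in Ioo 0 t, ∫⁻ y, D.indicator (fun p => H p.2) (s, y) ∂μ := by
        refine setLIntegral_congr_fun measurableSet_Ioo fun s hs => ?_
        rw [← lintegral_indicator measurableSet_Ioc]
        refine lintegral_congr fun y => ?_
        by_cases hy : y ∈ Ioc s t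
        · rw [indicator_of_mem hy, indicator_of_mem (show (s, y) ∈ D from ⟨hs.1, hy.1, hy.2⟩)]
        · rw [indicator_of_notMem hy, indicator_of_notMem]
          exact fun h => hy h.2
    _ ≤ ∫⁻ s, ∫⁻ y, D.indicator (fun p => H p.2) (s, y) ∂μ := setLIntegral_le_lintegral _ _
    _ = ∫⁻ y, (∫⁻ s, D.indicator (fun p => H p.2) (s, y)) ∂μ :=
        lintegral_lintegral_swap (f := fun s y => D.indicator (fun p => H p.2) (s, y))
          hm.aemeasurable
    _ ≤ ∫⁻ y, (Iic t).indicator (fun y => ENNReal.ofReal y * H y) y ∂μ := by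
        refine lintegral_mono fun y => ?_
        by_cases hy : y ∈ Iic t
        · rw [indicator_of_mem hy]
          calc ∫⁻ s, D.indicator (fun p => H p.2) (s, y)
              ≤ ∫⁻ s, (Ioo 0 y).indicator (fun _ => H y) s := by
                refine lintegral_mono fun s => ?_
                by_cases hs : (s, y) ∈ D
                · rw [indicator_of_mem hs, indicator_of_mem (show s ∈ Ioo 0 y from ⟨hs.1, hs.2.1⟩)]
                · rw [indicator_of_notMem hs]
                  exact zero_le
            _ = ENNReal.ofReal y * H y := by
                rw [lintegral_indicator measurableSet_Ioo, setLIntegral_const, Real.volume_Ioo,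
                  sub_zero, mul_comm]
        · rw [indicator_of_notMem hy]
          refine (lintegral_eq_zero_of_ae_eq_zero (Eventually.of_forall fun s => ?_)).le
          exact indicator_of_notMem (fun h => hy h.2.2) _
    _ = _ := lintegral_indicator measurableSet_Iic _

theorem average_le {μ : Measure ℝ} [NullSingletonClass μ] [SFinite μ] (h0 : μ (Iic 0) = 0)
    (hfin : ∀ t, μ (Iic t) < ⊤) (hpos : ∀ x, 0 < x → μ (Iic x) ≠ 0)
    {g : ℝ → ℝ≥0∞} (hg : Antitone g) {t : ℝ} (ht : 0 < t) :
    average g t ≤ 2 * (ratioIntegral μ (g ∘ halfPoint μ) t / ENNReal.ofReal t) +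
      g (halfPoint μ t) := by
  have hGm : Measurable fun y => g (halfPoint μ y) :=
    (hg.comp_monotone (halfPoint_mono h0 hfin)).measurable
  have hHm : Measurable fun y => g (halfPoint μ y) / μ (Iic y) :=
    hGm.div (monotone_measure_Iic μ).measurable
  have ht0 : ENNReal.ofReal t ≠ 0 := (ENNReal.ofReal_pos.2 ht).ne'
  have h1 : ∫⁻ s in Ioo 0 t, g s ≤
      2 * ratioIntegral μ (g ∘ halfPoint μ) t + g (halfPoint μ t) * ENNReal.ofReal t := by
    calc ∫⁻ s in Ioo 0 t, g s
        ≤ ∫⁻ s in Ioo 0 t, (2 * ∫⁻ y in Ioc s t, g (halfPoint μ y) / μ (Iic y) ∂μ +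
            g (halfPoint μ t)) :=
          setLIntegral_mono' measurableSet_Ioo fun s hs =>
            antitone_le_add h0 hfin hpos hg hs.1 hs.2.le
      _ = 2 * (∫⁻ s in Ioo 0 t, ∫⁻ y in Ioc s t, g (halfPoint μ y) / μ (Iic y) ∂μ) +
            g (halfPoint μ t) * ENNReal.ofReal t := by
          rw [lintegral_add_right _ measurable_const, lintegral_const_mul' _ _ ENNReal.ofNat_ne_top,
            setLIntegral_const, Real.volume_Ioo, sub_zero]
      _ ≤ _ := by
          gcongr
          refine (lintegral_Ioo_lintegral_Ioc_le hHm t).trans (le_of_eq ?_)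
          refine lintegral_congr fun y => ?_
          simp only [ratio, Function.comp, div_eq_mul_inv]
          ring
  calc average g t ≤ (ENNReal.ofReal t)⁻¹ *
        (2 * ratioIntegral μ (g ∘ halfPoint μ) t + g (halfPoint μ t) * ENNReal.ofReal t) := by
        rw [average]
        gcongr
    _ = 2 * (ratioIntegral μ (g ∘ halfPoint μ) t / ENNReal.ofReal t) +
        g (halfPoint μ t) * (ENNReal.ofReal t * (ENNReal.ofReal t)⁻¹) := by
        rw [div_eq_mul_inv]
        ring
    _ = _ := by rw [ENNReal.mul_inv_cancel ht0 ENNReal.ofReal_ne_top, mul_one]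

theorem TailCondition.lintegral_average_le {φ : ℝ≥0∞ → ℝ≥0∞} (hφ : IsDensity φ) {μ : Measure ℝ}
    [NullSingletonClass μ] [SFinite μ] (h0 : μ (Iic 0) = 0) (hfin : ∀ t, μ (Iic t) < ⊤)
    (huniv : μ univ = ⊤) {c : ℝ≥0} (hc : 0 < c) (h : TailCondition φ μ c) {g : ℝ → ℝ≥0∞}
    (hg : Antitone g) (hg1 : ∫⁻ y, primitive φ (g y) ∂μ ≤ 1) :
    ∫⁻ y, primitive φ (average g y / (4 * (16 / c + 1) : ℝ≥0)) ∂μ ≤ 1 := by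
  have hpos : ∀ x, 0 < x → μ (Iic x) ≠ 0 := fun x hx =>
    h.measure_Iic_ne_zero hφ hfin huniv hc hx
  have hGm : Measurable (g ∘ halfPoint μ) :=
    (hg.comp_monotone (halfPoint_mono h0 hfin)).measurable
  have hpG : Measurable fun y => primitive φ ((g ∘ halfPoint μ) y) :=
    (primitive_mono φ).measurable.comp hGm
  have hGint : ∫⁻ y, primitive φ ((g ∘ halfPoint μ) y) ∂μ ≤ 2 := by
    have := lintegral_comp_halfPoint h0 hfin huniv hpos
      ((primitive_mono φ).measurable.comp hg.measurable)
    refine (this.le.trans (mul_le_mul_right hg1 2)).trans (by rw [mul_one])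
  have hc0 : (c : ℝ≥0∞) ≠ 0 := by exact_mod_cast hc.ne'
  have hptw : ∀ y, 0 < y → 4 * primitive φ (average g y / (4 * (16 / c + 1) : ℝ≥0)) ≤
      primitive φ (c / 8 * (ratioIntegral μ (g ∘ halfPoint μ) y / ENNReal.ofReal y)) +
        primitive φ ((g ∘ halfPoint μ) y) := by
    intro y hy
    set R := ratioIntegral μ (g ∘ halfPoint μ) y / ENNReal.ofReal y
    set M := max ((c : ℝ≥0∞) / 8 * R) ((g ∘ halfPoint μ) y)
    -- The factor `16 / c` rewrites `2R` in terms of `(c / 8) R`, the quantity controlled by the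
    -- Hardy inequality; the summand 1 in `16 / c + 1` accounts for `g ∘ halfPoint μ`.
    have h2 : (2 : ℝ≥0∞) * R = (16 / c : ℝ≥0) * ((c : ℝ≥0∞) / 8 * R) := by
      rw [← mul_assoc]
      congr 1
      have : (c : ℝ≥0∞) / 8 = ((c / 8 : ℝ≥0) : ℝ≥0∞) := by
        rw [ENNReal.coe_div (by norm_num)]
        norm_cast
      rw [this, ← ENNReal.coe_mul, ← ENNReal.coe_ofNat]
      congr 1
      field_simp
      norm_num
    have h3 : average g y ≤ M * (16 / c + 1 : ℝ≥0) := by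
      refine (average_le h0 hfin hpos hg hy).trans ?_
      rw [h2, ENNReal.coe_add, mul_add, ENNReal.coe_one, mul_one, mul_comm M]
      gcongr
      · exact le_max_left _ _
      · exact le_max_right _ _
    -- The remaining factor 4 is two halvings, each of which gains a factor 2 in `Φ`.
    have h4 : average g y / (4 * (16 / c + 1) : ℝ≥0) =
        average g y / (16 / c + 1 : ℝ≥0) / 2 / 2 := by
      simp only [div_eq_mul_inv (_ : ℝ≥0∞), mul_assoc]
      congr 1
      have : (2 : ℝ≥0∞) = ((2 : ℝ≥0) : ℝ≥0∞) := rfl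
      rw [this, ← ENNReal.coe_inv (by positivity), ← ENNReal.coe_inv (by positivity),
        ← ENNReal.coe_inv (by positivity), ← ENNReal.coe_mul, ← ENNReal.coe_mul]
      congr 1
      field_simp
      norm_num
    rw [h4]
    calc 4 * primitive φ (average g y / (16 / c + 1 : ℝ≥0) / 2 / 2)
        = 2 * (2 * primitive φ (average g y / (16 / c + 1 : ℝ≥0) / 2 / 2)) := by
          rw [← mul_assoc]
          norm_num
      _ ≤ 2 * primitive φ (average g y / (16 / c + 1 : ℝ≥0) / 2) := by
          gcongr
          exact two_mul_primitive_half_le hφ.1 _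
      _ ≤ primitive φ (average g y / (16 / c + 1 : ℝ≥0)) := two_mul_primitive_half_le hφ.1 _
      _ ≤ primitive φ M := primitive_mono φ (ENNReal.div_le_of_le_mul h3)
      _ = max (primitive φ (c / 8 * R)) (primitive φ ((g ∘ halfPoint μ) y)) :=
          (primitive_mono φ).map_max
      _ ≤ _ := max_le le_self_add le_add_self
  have hsum : 4 * ∫⁻ y, primitive φ (average g y / (4 * (16 / c + 1) : ℝ≥0)) ∂μ ≤ 4 * 1 := by
    calc 4 * ∫⁻ y, primitive φ (average g y / (4 * (16 / c + 1) : ℝ≥0)) ∂μ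
        = ∫⁻ y, 4 * primitive φ (average g y / (4 * (16 / c + 1) : ℝ≥0)) ∂μ :=
          (lintegral_const_mul' _ _ ENNReal.ofNat_ne_top).symm
      _ ≤ ∫⁻ y, (primitive φ (c / 8 * (ratioIntegral μ (g ∘ halfPoint μ) y / ENNReal.ofReal y)) +
            primitive φ ((g ∘ halfPoint μ) y)) ∂μ := by
          refine lintegral_mono_ae ?_
          filter_upwards [ae_pos_of_measure_Iic_zero h0] with y hy using hptw y hy
      _ ≤ 2 + 2 := by
          rw [lintegral_add_right _ hpG]
          exact add_le_add ((h.lintegral_hardy_le hφ h0 hfin huniv hc hGm).trans hGint) hGint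
      _ = 4 * 1 := by norm_num
  exact (ENNReal.mul_le_mul_iff_right (by norm_num) ENNReal.ofNat_ne_top).1 hsum

/-! ### The measure with density a weight -/

/-- The measure `u(x) dx` on `(0, ∞)`. -/
noncomputable def weightMeasure (u : ℝ → ℝ) : Measure ℝ :=
  (volume.restrict (Ioi 0)).withDensity fun x => ENNReal.ofReal (u x)

instance (u : ℝ → ℝ) : SFinite (weightMeasure u) := by
  unfold weightMeasure
  infer_instance

instance (u : ℝ → ℝ) : NullSingletonClass (weightMeasure u) :=
  ⟨fun x => withDensity_absolutelyContinuous _ _ (measure_singleton x)⟩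

theorem weightMeasure_univ (u : ℝ → ℝ) :
    weightMeasure u univ = ∫⁻ x in Ioi 0, ENNReal.ofReal (u x) := by
  rw [weightMeasure, withDensity_apply _ MeasurableSet.univ, Measure.restrict_univ]

theorem weightMeasure_Iic (u : ℝ → ℝ) (x : ℝ) : weightMeasure u (Iic x) = cumul u x := by
  rw [weightMeasure, withDensity_apply _ measurableSet_Iic,
    Measure.restrict_restrict measurableSet_Iic, inter_comm, Ioi_inter_Iic, cumul]
  exact setLIntegral_congr Ioo_ae_eq_Ioc.symm

theorem setLIntegral_weightMeasure {u : ℝ → ℝ} (hu : IsWeight u) {h : ℝ → ℝ≥0∞}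
    (hh : Measurable h) {S : Set ℝ} (hS : MeasurableSet S) :
    ∫⁻ x in S, h x ∂(weightMeasure u) = ∫⁻ x in S ∩ Ioi 0, h x * ENNReal.ofReal (u x) := by
  have hm : AEMeasurable (fun x => ENNReal.ofReal (u x)) (volume.restrict (S ∩ Ioi 0)) :=
    (hu.2.aestronglyMeasurable.aemeasurable.ennreal_ofReal).mono_measure
      (Measure.restrict_mono_set _ inter_subset_right)
  rw [weightMeasure, restrict_withDensity hS, Measure.restrict_restrict hS,
    lintegral_withDensity_eq_lintegral_mul₀ hm hh.aemeasurable]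
  simp only [Pi.mul_apply, mul_comm]

theorem tail_weightMeasure {φ : ℝ≥0∞ → ℝ≥0∞} {u : ℝ → ℝ} (hu : IsWeight u) (l : ℝ≥0) {x : ℝ}
    (hx : 0 < x) : tail φ (weightMeasure u) l x = beta (primitive φ) u l x := by
  have hm : Measurable fun y : ℝ => primitive φ (l / ENNReal.ofReal y) :=
    (primitive_mono φ).measurable.comp (measurable_const.div ENNReal.measurable_ofReal)
  rw [tail, setLIntegral_weightMeasure hu hm measurableSet_Ioi,
    inter_eq_left.2 (Ioi_subset_Ioi hx.le), beta]

theorem BetaCondition.exists_tailCondition {φ : ℝ≥0∞ → ℝ≥0∞} {u : ℝ → ℝ} (hu : IsWeight u)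
    (h : BetaCondition φ u) : ∃ c : ℝ≥0, 0 < c ∧ TailCondition φ (weightMeasure u) c := by
  obtain ⟨c, hc, h⟩ := h
  refine ⟨c, hc, fun l hl x hx => le_trans (le_of_eq ?_) (h l hl x hx)⟩
  have hr := measurable_ratio (weightMeasure u)
  have hm : Measurable fun y => inverse φ (c * tail φ (weightMeasure u) l x / l *
      ratio (weightMeasure u) y) * ratio (weightMeasure u) y :=
    ((inverse_mono φ).measurable.comp (hr.const_mul _)).mul hr
  rw [setLIntegral_weightMeasure hu hm measurableSet_Iic, tail_weightMeasure hu l hx, inter_comm,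
    Ioi_inter_Iic, setLIntegral_congr Ioo_ae_eq_Ioc.symm]
  refine lintegral_congr fun y => ?_
  rw [ratio, weightMeasure_Iic, mul_assoc]
  congr 1
  simp only [div_eq_mul_inv]
  ring

/-- Local integrability covers `[x, z]`, so only the behaviour of the weight at 0 can make `U`
infinite. -/
theorem IsWeight.cumul_lt_top {u : ℝ → ℝ} (hu : IsWeight u) {x : ℝ} (hx : 0 < x)
    (h : cumul u x < ⊤) (z : ℝ) : cumul u z < ⊤ := by
  have h1 : IntegrableOn u (Icc x z) :=
    hu.2.integrableOn_compact_subset (fun y hy => hx.trans_le hy.1) isCompact_Icc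
  have h2 : ∫⁻ y in Icc x z, ENNReal.ofReal (u y) < ⊤ := by
    refine lt_of_le_of_lt (lintegral_mono fun y => ?_) h1.2
    exact Real.ofReal_le_enorm (u y)
  refine lt_of_le_of_lt ?_ (ENNReal.add_lt_top.2 ⟨h, h2⟩)
  refine (lintegral_mono_set fun y hy => ?_).trans (lintegral_union_le _ _ _)
  rcases lt_or_ge y x with hyx | hyx
  · exact Or.inl ⟨hy.1, hyx⟩
  · exact Or.inr ⟨hyx, hy.2.le⟩

/-! ### Reduction of the gauge inequality to a modular one -/

theorem rearrangement_antitone (f : ℝ → ℝ≥0∞) : Antitone (rearrangement f) :=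
  fun _ _ hab => sInf_le_sInf fun _ hl => hl.trans (ENNReal.ofReal_le_ofReal hab)

/-- Each `l` admissible for `h` makes `l * C` admissible for `g`; passing to the infimum compares
the gauges. -/
theorem gauge_le_mul_gauge {Φ : ℝ≥0∞ → ℝ≥0∞} {u : ℝ → ℝ} {g h : ℝ → ℝ≥0∞} {C : ℝ≥0} (hC : 0 < C)
    (H : ∀ l : ℝ≥0∞, 0 < l → l < ⊤ → ∫⁻ x in Ioi 0, Φ (h x / l) * ENNReal.ofReal (u x) ≤ 1 →
      ∫⁻ x in Ioi 0, Φ (g x / l / C) * ENNReal.ofReal (u x) ≤ 1) :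
    gauge Φ u g ≤ C * gauge Φ u h := by
  have hC0 : (C : ℝ≥0∞) ≠ 0 := by exact_mod_cast hC.ne'
  rw [mul_comm, ← ENNReal.div_le_iff_le_mul (Or.inl hC0) (Or.inl ENNReal.coe_ne_top)]
  refine le_sInf fun l ⟨hl0, hlt, hl⟩ => ?_
  rw [ENNReal.div_le_iff_le_mul (Or.inl hC0) (Or.inl ENNReal.coe_ne_top)]
  refine sInf_le ⟨ENNReal.mul_pos hl0.ne' hC0, ENNReal.mul_lt_top hlt ENNReal.coe_lt_top, ?_⟩
  convert H l hl0 hlt hl using 5 with x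
  rw [div_eq_mul_inv, div_eq_mul_inv, div_eq_mul_inv,
    ENNReal.mul_inv (Or.inl hl0.ne') (Or.inl hlt.ne), mul_assoc]

theorem average_div (g : ℝ → ℝ≥0∞) {l : ℝ≥0∞} (hl : 0 < l) (x : ℝ) :
    average g x / l = average (fun t => g t / l) x := by
  simp only [average, div_eq_mul_inv]
  rw [lintegral_mul_const' _ _ (ENNReal.inv_lt_top.2 hl).ne, mul_assoc]

theorem eq_zero_of_lintegral_ne_top {φ : ℝ≥0∞ → ℝ≥0∞} (hφ : IsDensity φ) {u : ℝ → ℝ}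
    {x : ℝ} (hU : cumul u x = ⊤) {g : ℝ → ℝ≥0∞} (hg : Antitone g)
    (h : ∫⁻ y in Ioi 0, primitive φ (g y) * ENNReal.ofReal (u y) ≠ ⊤) : g x = 0 := by
  by_contra hx
  have hp := hφ.primitive_pos (pos_iff_ne_zero.2 hx)
  refine h (top_unique ?_)
  calc (⊤ : ℝ≥0∞) = primitive φ (g x) * cumul u x := by rw [hU, ENNReal.mul_top hp.ne']
    _ ≤ ∫⁻ y in Ioo 0 x, primitive φ (g x) * ENNReal.ofReal (u y) := lintegral_const_mul_le _ _
    _ ≤ ∫⁻ y in Ioo 0 x, primitive φ (g y) * ENNReal.ofReal (u y) := by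
        refine setLIntegral_mono' measurableSet_Ioo fun y hy => ?_
        gcongr
        exact primitive_mono φ (hg hy.2.le)
    _ ≤ _ := lintegral_mono_set Ioo_subset_Ioi_self

end OrliczLorentz

/-! ### The gauge inequality for the weight -/

theorem theorem2p4
    (φ : ℝ≥0∞ → ℝ≥0∞) (hφ : OrliczLorentz.IsDensity φ)
    (hdoubling : OrliczLorentz.IsDoubling (OrliczLorentz.primitive φ))
    (u : ℝ → ℝ) (hu : OrliczLorentz.IsWeight u)
    (huinf : ∫⁻ x in Ioi 0, ENNReal.ofReal (u x) = ⊤)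
    (hα : OrliczLorentz.AlphaCondition φ (OrliczLorentz.primitive φ) u ∨
      OrliczLorentz.AlphaCondition φ (OrliczLorentz.complementary φ) u)
    (hβ : OrliczLorentz.BetaCondition φ u) :
    ∃ C : ℝ≥0, 0 < C ∧ ∀ f : ℝ → ℝ≥0∞, AEMeasurable f (volume.restrict (Ioi 0)) →
      OrliczLorentz.gauge (OrliczLorentz.primitive φ) u
          (OrliczLorentz.average (OrliczLorentz.rearrangement f)) ≤
        C * OrliczLorentz.gauge (OrliczLorentz.primitive φ) u
          (OrliczLorentz.rearrangement f) := by
  open OrliczLorentz in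
  obtain ⟨c, hc, htail⟩ := hβ.exists_tailCondition hu
  refine ⟨4 * (16 / c + 1), by positivity, fun f _ => gauge_le_mul_gauge (by positivity) ?_⟩
  intro l hl0 _ hl
  have hg : Antitone fun t => rearrangement f t / l :=
    fun a b hab => ENNReal.div_le_div_right (rearrangement_antitone f hab) l
  simp only [average_div _ hl0]
  -- Either `U` is finite everywhere and the measure argument applies, or `U = ∞` on `(0, ∞)`. In
  -- the latter case a finite modular forces the nonincreasing function, and with it its average, to
  -- vanish.
  by_cases hfin : ∃ x, 0 < x ∧ cumul u x < ⊤
  · obtain ⟨x, hx, hxU⟩ := hfin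
    have hm : Measurable fun y => primitive φ (rearrangement f y / l) :=
      (primitive_mono φ).measurable.comp hg.measurable
    have hm' : Measurable fun y => primitive φ
        (average (fun t => rearrangement f t / l) y / (4 * (16 / c + 1) : ℝ≥0)) := by
      refine (primitive_mono φ).measurable.comp (Measurable.div_const (Measurable.mul ?_ ?_) _)
      · exact ENNReal.measurable_ofReal.inv
      · refine Monotone.measurable fun a b hab => ?_
        exact lintegral_mono_set (Ioo_subset_Ioo_right hab)
    have heq := fun (h : ℝ → ℝ≥0∞) (hh : Measurable h) =>
      setLIntegral_weightMeasure hu hh MeasurableSet.univ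
    simp only [univ_inter, setLIntegral_univ] at heq
    rw [← heq _ hm] at hl
    rw [← heq _ hm']
    refine htail.lintegral_average_le hφ ?_ (fun t => ?_) ?_ hc hg hl
    · simp [weightMeasure_Iic, cumul]
    · rw [weightMeasure_Iic]
      exact hu.cumul_lt_top hx hxU t
    · rw [weightMeasure_univ, huinf]
  · have hzero : ∀ x, 0 < x → rearrangement f x / l = 0 := fun x hx =>
      eq_zero_of_lintegral_ne_top hφ (not_lt_top_iff.1 fun hlt => hfin ⟨x, hx, hlt⟩) hg
        (hl.trans_lt ENNReal.one_lt_top).ne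
    have hav : ∀ x, average (fun t => rearrangement f t / l) x = 0 := fun x => by
      rw [OrliczLorentz.average, setLIntegral_congr_fun measurableSet_Ioo fun y hy => hzero y hy.1,
        lintegral_zero, mul_zero]
    simp [hav, primitive_zero]
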